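/- **Cost model.** Let $\mathsf K$ be a field. A program over $\mathsf K$ (an algebraic computation tree, i.e. a straight-line program that may also branch on tests $x=0$) performs instructions $\delta:=x\ \mathrm{op}\ y$ with $\mathrm{op}\in\{+,-,\times,\div\}$, assignments $\delta:=c$ with $c\in\mathsf K$, and tests "$x=0$?". Each instruction and each assignment counts as one operation, and each test as $w$ operations, where $w\ge 0$ is an arbitrary fixed integer. Running times are bounds valid for all admissible inputs. Let $\mathsf M,\mathsf G:\mathbb N\to\mathbb N$ be such that, for every $n$, * two polynomials in $\mathsf K[x]$ of degree at most $n$ can be multiplied by a straight-line program with at most $\mathsf M(n)$ ring operations (no division, no test); * the extended gcd problem in degree $2n$ can be solved with at most $\mathsf G(n)$ operations: given $a,b\in\mathsf K[x]$ with $\deg b<\deg a=2n$, compute a greatest common divisor $d$ of $a$ and $b$ and cofactors $s,t$ with $sa+tb=d$, where $\deg s<\max(1,\deg b-\deg d)$ and $\deg t<\max(1,\deg a-\deg d)$ (for $b=0$ the first bound is read as $\deg s<1$). **Setting.** Let $A\in\mathsf K^{n\times n}$, $u\in\mathsf K^{1\times n}$, $v\in\mathsf K^{n\times 1}$, $h_k=uA^kv$,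 and let $H=(h_{i+j-2})_{1\le i,j\le n}$ and $H_A=(h_{i+j-1})_{1\le i,j\le n}$ be the associated Hankel matrices. Assume that $H$ and $A$ are non-singular (hence so is $H_A$). Let $f$ be the minimum polynomial of $h_0,\dots,h_{2n-1}$, i.e. the monic polynomial $f=\sum_j f_jx^j$ of least degree such that $\sum_{j=0}^{\deg f} f_jh_{i+j}=0$ for all $i\ge 0$ with $i+\deg f\le 2n-1$. For $B=(b_{ij})\in\mathsf K^{n\times n}$ let $\sigma_k(B)=\sum_{i+j-2=k}b_{ij}$ (an empty sum is $0$). **Proposition.** There is an absolute constant $C$ such that, for all $\mathsf K,w,\mathsf M,\mathsf G$ as above and every $n$, there is a program over $\mathsf K$ that, for all $A,u,v$ as above, given the coefficients of $f$ and the entries of $H$ and $H_A$, computes the anti-diagonal sums $\sigma_k(H^{-1})$ and $\sigma_k(H_A^{-1})$ for all $0\le k\le 2n-1$ with at most $\mathsf G(n)+C\,\mathsf M(n)$ operations in $\mathsf K$. That is, they can be computed in $\mathsf G(n)+O(\mathsf M(n))$ operations. -/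

import Mathlib

open Polynomial

namespace HankelSums

universe u

/-! ### Arithmetic programs over a field -/

/-- The four arithmetic operations. -/
inductive ArithOp where
  | add
  | sub
  | mul
  | div

/-- The (partial) meaning of an arithmetic operation: division by zero is undefined. -/
noncomputable def ArithOp.eval {K : Type u} [Field K] : ArithOp → K → K → Option K
  | .add, a, b => some (a + b)
  | .sub, a, b => some (a - b)
  | .mul, a, b => some (a * b)
  | .div, a, b => open Classical in if b = 0 then none else some (a / b)

/-- Algebraic computation trees over `K` (straight-line programs with zero tests).
The variables available at the current node are indexed by `ι`; a constant assignment
`δ := c` and an arithmetic instruction `δ := x op y` create one new variable, so that the rest of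
the program sees the variables `Option ι`, the new one being `none`. `branch i P Q` continues
with `P` if the variable `i` is zero and with `Q` otherwise. `halt sel` stops, the result with
index `o : ω` being the variable `sel o`. -/
inductive Program (K : Type u) (ω : Type) : Type → Type (max u 1)
  | halt {ι : Type} (sel : ω → ι) : Program K ω ι
  | const {ι : Type} (c : K) (rest : Program K ω (Option ι)) : Program K ω ι
  | arith {ι : Type} (op : ArithOp) (i j : ι) (rest : Program K ω (Option ι)) : Program K ω ι
  | branch {ι : Type} (i : ι) (ifZero ifNonzero : Program K ω ι) : Program K ω ι

/-- The values `x` of the old variables together with the value `c` of the new one. -/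
def extend {K : Type u} {ι : Type} (x : ι → K) (c : K) : Option ι → K
  | none => c
  | some i => x i

/-- Execution on the input `x`: the results, together with the number of operations performed.
Each constant assignment and each arithmetic instruction counts for one operation, each zero test
for `w` operations. The value is `none` if a division by zero occurs. -/
noncomputable def Program.run {K : Type u} [Field K] {ω : Type} (w : ℕ) :
    {ι : Type} → Program K ω ι → (ι → K) → Option ((ω → K) × ℕ)
  | _, .halt sel, x => some (fun o => x (sel o), 0)
  | _, .const c rest, x =>
      (rest.run w (extend x c)).map fun r => (r.1, r.2 + 1)
  | _, .arith op i j rest, x =>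
      (op.eval (x i) (x j)).bind fun c =>
        (rest.run w (extend x c)).map fun r => (r.1, r.2 + 1)
  | _, .branch i P Q, x =>
      open Classical in
      (if x i = 0 then P.run w x else Q.run w x).map fun r => (r.1, r.2 + w)

/-- On the input `x`, the program `P` returns `y` after at most `N` operations
(each zero test being counted for `w` operations). -/
def Program.Computes {K : Type u} [Field K] {ω ι : Type} (w : ℕ) (P : Program K ω ι)
    (x : ι → K) (y : ω → K) (N : ℕ) : Prop :=
  ∃ t : ℕ, P.run w x = some (y, t) ∧ t ≤ N

/-- Straight-line programs that use the ring operations only: no division, no test. -/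
def Program.IsRingStraightLine {K : Type u} {ω : Type} :
    {ι : Type} → Program K ω ι → Prop
  | _, .halt _ => True
  | _, .const _ rest => rest.IsRingStraightLine
  | _, .arith op _ _ rest => op ≠ ArithOp.div ∧ rest.IsRingStraightLine
  | _, .branch _ _ _ => False

/-! ### The cost functions -/

/-- `M` bounds the cost of polynomial multiplication: for each `n`, two polynomials of degree at
most `n` can be multiplied by a straight-line program with at most `M n` ring operations.
(There is no test in such a program, so that the cost of a test is irrelevant.) -/
def IsMulCost (K : Type u) [Field K] (M : ℕ → ℕ) : Prop :=
  ∀ n : ℕ, ∃ P : Program K (Fin (2 * n + 1)) (Fin (n + 1) ⊕ Fin (n + 1)),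
    P.IsRingStraightLine ∧
    ∀ a b : K[X], a.natDegree ≤ n → b.natDegree ≤ n →
      P.Computes 0 (Sum.elim (fun i => a.coeff i) (fun i => b.coeff i))
        (fun k => (a * b).coeff k) (M n)

/-- `d` is a greatest common divisor of `a` and `b`, and `s`, `t` are Bézout cofactors of the size
produced by the extended Euclidean algorithm: `deg s < deg b - deg d` and
`deg t < deg a - deg d`, constants being admitted in any case (when, say, `b` divides `a`). -/
structure IsExtGcd {K : Type u} [Field K] (a b d s t : K[X]) : Prop where
  dvd_left : d ∣ a
  dvd_right : d ∣ b
  bezout : s * a + t * b = d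
  degree_left : s.natDegree < max 1 (b.natDegree - d.natDegree)
  degree_right : t.natDegree < max 1 (a.natDegree - d.natDegree)

/-- `G` bounds the cost of the extended gcd problem: for each `n` there is a program that, for
all `a` of degree `2 n` and all `b` of smaller degree, computes a gcd of `a` and `b` and its
cofactors with at most `G n` operations. All polynomials are given by their coefficients of
index `0, …, 2 n`. -/
def IsExtGcdCost (K : Type u) [Field K] (w : ℕ) (G : ℕ → ℕ) : Prop :=
  ∀ n : ℕ, ∃ P : Program K (Fin (2 * n + 1) ⊕ Fin (2 * n + 1) ⊕ Fin (2 * n + 1))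
      (Fin (2 * n + 1) ⊕ Fin (2 * n + 1)),
    ∀ a b : K[X], a.degree = ((2 * n : ℕ) : WithBot ℕ) → b.degree < a.degree →
      ∃ d s t : K[X], IsExtGcd a b d s t ∧
        P.Computes w (Sum.elim (fun i => a.coeff i) (fun i => b.coeff i))
          (Sum.elim (fun i => d.coeff i)
            (Sum.elim (fun i => s.coeff i) (fun i => t.coeff i))) (G n)

/-! ### Sequences, Hankel matrices, anti-diagonal sums -/

/-- The sequence `h k = u A ^ k v`. -/
def krylovSeq {K : Type u} [Field K] {n : ℕ} (A : Matrix (Fin n) (Fin n) K)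
    (u v : Fin n → K) (k : ℕ) : K :=
  dotProduct u (Matrix.mulVec (A ^ k) v)

/-- The `n × n` Hankel matrix with entry `h (i + j)` in position `(i, j)`, indices from `0`. -/
def hankel {K : Type u} (n : ℕ) (h : ℕ → K) : Matrix (Fin n) (Fin n) K :=
  Matrix.of fun i j => h ((i : ℕ) + (j : ℕ))

/-- `p` generates the finite sequence `h 0, …, h (N - 1)`:
`∑ j, p_j h (i + j) = 0` whenever all the terms belong to the sequence. -/
def Generates {K : Type u} [Field K] (h : ℕ → K) (N : ℕ) (p : K[X]) : Prop :=
  ∀ i : ℕ, i + p.natDegree < N →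
    ∑ j ∈ Finset.range (p.natDegree + 1), p.coeff j * h (i + j) = 0

/-- `f` is a minimum polynomial of the finite sequence `h 0, …, h (N - 1)`: a monic polynomial
of least degree that generates it. -/
structure IsSeqMinpoly {K : Type u} [Field K] (h : ℕ → K) (N : ℕ) (f : K[X]) : Prop where
  monic : f.Monic
  generates : Generates h N f
  minimal : ∀ p : K[X], p.Monic → Generates h N p → f.natDegree ≤ p.natDegree

/-- The anti-diagonal sum `σ_k(B)`: the sum of the entries `B i j` with `i + j = k`, indices
from `0`. -/
def antidiagSum {K : Type u} [Field K] {n : ℕ} (B : Matrix (Fin n) (Fin n) K) (k : ℕ) : K :=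
  ∑ i : Fin n, ∑ j : Fin n, if (i : ℕ) + (j : ℕ) = k then B i j else 0

end HankelSums

/-! Let `ℓ p = u p(A) v`. By Cayley–Hamilton `ℓ` kills the multiples of the characteristic
polynomial, and non-singularity of `H` forces `f` to be that polynomial
(`IsSeqMinpoly.eq_charpoly`). Let `g = polarPart ℓ f 1`, the numerator of the generating series of
`h` over the denominator `f`. Multiplying the argument of `ℓ` by `p` multiplies this numerator by
`p` modulo `f` (`dvd_polarPart_sub`), and `g` is invertible modulo `f` (`isCoprime_polarPart`). If
`q g ≡ 1` mod `f`, then `H⁻¹` is the Bezoutian of `f` and `q` (`inv_hankel`), whose anti-diagonal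
sums are the coefficients of the Wronskian `f' q - f q'` (`antidiagSum_inv_hankel`).

The matrix `H_A` belongs to the form `ℓ (x ·)`, whose numerator is `x g` modulo `f`. Its Bezoutian
partner is thus `q / x` modulo `f`, obtained in linear time because `f(0) = ± det A ≠ 0`.

For the cost, `g` and the two Wronskians take a bounded number of products. Multiplying `f` and `g`
by `x ^ n` makes the inversion one extended gcd in degree exactly `2 n`. All linear overhead is
absorbed by `2 n + 1 ≤ M n` (`IsMulCost.two_mul_add_one_le`). -/

namespace HankelSums

/-! ### Composition of programs and the cost of basic polynomial operations. -/

section Programs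

variable {K : Type u}

/-- Substitution of variables. -/
def Program.rename {ω : Type} : {ι κ : Type} → (ι → κ) → Program K ω ι → Program K ω κ
  | _, _, ρ, .halt sel => .halt (ρ ∘ sel)
  | _, _, ρ, .const c rest => .const c (rest.rename (Option.map ρ))
  | _, _, ρ, .arith op i j rest => .arith op (ρ i) (ρ j) (rest.rename (Option.map ρ))
  | _, _, ρ, .branch i P Q => .branch (ρ i) (P.rename ρ) (Q.rename ρ)

/-- Sequential composition: the second program has access to the results of the first one and to
the original variables. -/
def Program.andThen {ω ω' : Type} :
    {ι : Type} → Program K ω ι → Program K ω' (ω ⊕ ι) → Program K ω' ι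
  | _, .halt sel, Q => Q.rename (Sum.elim sel id)
  | _, .const c rest, Q => .const c (rest.andThen (Q.rename (Sum.map id some)))
  | _, .arith op i j rest, Q => .arith op i j (rest.andThen (Q.rename (Sum.map id some)))
  | _, .branch i P P', Q => .branch i (P.andThen Q) (P'.andThen Q)

theorem extend_comp_map {ι κ : Type} (ρ : ι → κ) (x : κ → K) (c : K) :
    extend x c ∘ Option.map ρ = extend (x ∘ ρ) c := by
  funext i; cases i <;> rfl

theorem elim_extend_comp_map {ω ι : Type} (y : ω → K) (x : ι → K) (c : K) :
    Sum.elim y (extend x c) ∘ Sum.map id some = Sum.elim y x := by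
  funext i; cases i <;> rfl

variable [Field K]

theorem Program.run_rename (w : ℕ) {ω ι κ : Type} (ρ : ι → κ) (P : Program K ω ι) (x : κ → K) :
    (P.rename ρ).run w x = P.run w (x ∘ ρ) := by
  induction P generalizing κ with
  | halt sel => rfl
  | const c rest ih => simp only [rename, run, ih, extend_comp_map]
  | arith op i j rest ih => simp only [rename, run, ih, extend_comp_map, Function.comp]
  | branch i P Q ihP ihQ => simp only [rename, run, ihP, ihQ, Function.comp]

theorem Program.run_andThen (w : ℕ) {ω ω' ι : Type} (P : Program K ω ι)
    (Q : Program K ω' (ω ⊕ ι)) (x : ι → K) {y : ω → K} {z : ω' → K} {s t : ℕ}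
    (hP : P.run w x = some (y, s)) (hQ : Q.run w (Sum.elim y x) = some (z, t)) :
    (P.andThen Q).run w x = some (z, s + t) := by
  induction P generalizing s with
  | halt sel =>
    simp only [run, Option.some.injEq, Prod.mk.injEq] at hP
    obtain ⟨rfl, rfl⟩ := hP
    rw [andThen, run_rename, zero_add, ← hQ]
    congr 1
    funext i; cases i <;> rfl
  | const c rest ih =>
    simp only [run, Option.map_eq_some_iff, Prod.mk.injEq, Prod.exists] at hP
    obtain ⟨y', s', h, rfl, rfl⟩ := hP
    rw [andThen, run, ih (Q.rename (Sum.map id some)) _ h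
      (by rw [run_rename, elim_extend_comp_map, hQ])]
    simp only [Option.map_some]
    congr 2; omega
  | arith op i j rest ih =>
    simp only [run, Option.bind_eq_some_iff, Option.map_eq_some_iff, Prod.mk.injEq,
      Prod.exists] at hP
    obtain ⟨c, hc, y', s', h, rfl, rfl⟩ := hP
    rw [andThen, run, hc, Option.bind_some, ih (Q.rename (Sum.map id some)) _ h
      (by rw [run_rename, elim_extend_comp_map, hQ])]
    simp only [Option.map_some]
    congr 2; omega
  | branch i P P' ihP ihP' =>
    simp only [run, Option.map_eq_some_iff, Prod.mk.injEq, Prod.exists] at hP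
    obtain ⟨y', s', h, rfl, rfl⟩ := hP
    rw [andThen, run]
    split_ifs at h ⊢
    · rw [ihP Q x h hQ, Option.map_some]
      congr 2; omega
    · rw [ihP' Q x h hQ, Option.map_some]
      congr 2; omega

/-- Transfers the multiplication cost, measured with tests of weight 0, to any weight of tests. -/
theorem Program.IsRingStraightLine.run_eq (w w' : ℕ) {ω ι : Type} {P : Program K ω ι}
    (hP : P.IsRingStraightLine) (x : ι → K) : P.run w x = P.run w' x := by
  induction P with
  | halt sel => rfl
  | const c rest ih => simp only [run, ih hP]
  | arith op i j rest ih => simp only [run, ih hP.2]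
  | branch i P Q _ _ => exact hP.elim

/-- A straight-line program that performs `m` operations has only `m` computed values among which
to choose its results, apart from the inputs. -/
theorem Program.IsRingStraightLine.exists_results (w : ℕ) {ω ι : Type} {P : Program K ω ι}
    (hP : P.IsRingStraightLine) :
    ∃ (m : ℕ) (sel : ω → ι ⊕ Fin m) (val : (ι → K) → Fin m → K),
      ∀ x, P.run w x = some (fun o => Sum.elim x (val x) (sel o), m) := by
  induction P with
  | halt sel => exact ⟨0, fun o => .inl (sel o), fun _ => Fin.elim0, fun x => rfl⟩
  | @const ι c rest ih =>
    obtain ⟨m, sel, val, h⟩ := ih hP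
    refine ⟨m + 1, fun o => Sum.elim (fun i => i.elim (.inr 0) .inl) (fun k => .inr k.succ) (sel o),
      fun x => Fin.cons c (val (extend x c)), fun x => ?_⟩
    simp only [run, h, Option.map_some]
    congr 2
    funext o
    rcases sel o with (_ | i) | k <;> simp [extend]
  | @arith ι op i j rest ih =>
    obtain ⟨m, sel, val, h⟩ := ih hP.2
    have hop : ∀ a b : K, ∃ c, op.eval a b = some c := by
      intro a b
      have := hP.1
      cases op
      exacts [⟨_, rfl⟩, ⟨_, rfl⟩, ⟨_, rfl⟩, absurd rfl this]
    choose r hr using hop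
    refine ⟨m + 1, fun o => Sum.elim (fun i => i.elim (.inr 0) .inl) (fun k => .inr k.succ) (sel o),
      fun x => Fin.cons (r (x i) (x j)) (val (extend x (r (x i) (x j)))), fun x => ?_⟩
    simp only [run, hr, h, Option.map_some, Option.bind_some]
    congr 2
    funext o
    rcases sel o with (_ | i) | k <;> simp [extend]
  | branch i P Q _ _ => exact hP.elim

/-- The `2 n + 1` coefficients of a product are pairwise distinct functions, and none of them is
an input. -/
theorem IsMulCost.two_mul_add_one_le {M : ℕ → ℕ} (hM : IsMulCost K M) (n : ℕ) :
    2 * n + 1 ≤ M n := by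
  obtain ⟨P, hP, hmul⟩ := hM n
  obtain ⟨m, sel, val, hrun⟩ := hP.exists_results 0
  have key : ∀ a b : K[X], a.natDegree ≤ n → b.natDegree ≤ n →
      m ≤ M n ∧ ∀ k : Fin (2 * n + 1), (a * b).coeff k =
        Sum.elim (Sum.elim (fun i : Fin (n + 1) => a.coeff i) (fun i : Fin (n + 1) => b.coeff i))
          (val (Sum.elim (fun i => a.coeff i) (fun i => b.coeff i))) (sel k) := by
    intro a b ha hb
    obtain ⟨t, ht, htM⟩ := hmul a b ha hb
    rw [hrun, Option.some.injEq, Prod.mk.injEq] at ht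
    exact ⟨ht.2 ▸ htM, fun k => (congrFun ht.1 k).symm⟩
  refine le_trans ?_ (key 0 0 (by simp) (by simp)).1
  have hX : ∀ i ≤ n, (X ^ i : K[X]).natDegree ≤ n := fun i hi => by simpa using hi
  -- An input cannot serve as a result: set it to 1 and the other factor to 0, and the product
  -- vanishes.
  have hsel : ∀ k, ∃ j, sel k = .inr j := by
    intro k
    rcases hk : sel k with (i | i) | j
    · have := (key (X ^ (i : ℕ)) 0 (hX _ (by omega)) (by simp)).2 k
      simp [hk] at this
    · have := (key 0 (X ^ (i : ℕ)) (by simp) (hX _ (by omega))).2 k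
      simp [hk] at this
    · exact ⟨j, rfl⟩
  choose j hj using hsel
  have hinj : Function.Injective j := by
    intro k l hkl
    by_contra hne
    -- These factors have product `X ^ k`, which separates coefficient `k` from coefficient `l`.
    have h := (key (X ^ min (k : ℕ) n) (X ^ ((k : ℕ) - n)) (hX _ (by omega)) (hX _ (by omega))).2
    have hk := h k
    have hl := h l
    rw [hj, Sum.elim_inr, ← pow_add, coeff_X_pow] at hk hl
    rw [hkl, ← hl, if_pos (by omega), if_neg (by have := Fin.val_ne_of_ne hne; omega)] at hk
    exact one_ne_zero hk
  simpa using Fintype.card_le_of_injective j hinj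

/-! ### Uniform feasibility -/

/-- A single program computes, for every instance `τ`, the values `Y τ` from the values `X τ` with
at most `N` operations. -/
def Feasible (w : ℕ) {T : Sort*} {ι ω : Type} (X : T → ι → K) (Y : T → ω → K) (N : ℕ) : Prop :=
  ∃ P : Program K ω ι, ∀ τ, P.Computes w (X τ) (Y τ) N

namespace Feasible

variable {w : ℕ} {T : Sort*} {ι ω ω' : Type} {X : T → ι → K} {Y : T → ω → K} {Z : T → ω' → K}
  {N N' : ℕ}

theorem mono (h : Feasible w X Y N) (hN : N ≤ N') : Feasible w X Y N' := by
  obtain ⟨P, hP⟩ := h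
  exact ⟨P, fun τ => let ⟨t, h, ht⟩ := hP τ; ⟨t, h, ht.trans hN⟩⟩

theorem congr {Y' : T → ω → K} (h : Feasible w X Y N) (hY : ∀ τ o, Y τ o = Y' τ o) :
    Feasible w X Y' N := by
  rwa [← show Y = Y' from funext fun τ => funext (hY τ)]

theorem select (X : T → ι → K) (sel : ω → ι) : Feasible w X (fun τ o => X τ (sel o)) 0 :=
  ⟨.halt sel, fun _ => ⟨0, rfl, le_rfl⟩⟩

theorem entry (i : ι) : Feasible w X (fun τ (_ : Unit) => X τ i) 0 :=
  select X fun _ => i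

theorem trans (hY : Feasible w X Y N) (hZ : Feasible w (fun τ => Sum.elim (Y τ) (X τ)) Z N') :
    Feasible w X Z (N + N') := by
  obtain ⟨P, hP⟩ := hY
  obtain ⟨Q, hQ⟩ := hZ
  refine ⟨P.andThen Q, fun τ => ?_⟩
  obtain ⟨s, hs, hsN⟩ := hP τ
  obtain ⟨t, ht, htN⟩ := hQ τ
  exact ⟨s + t, P.run_andThen w Q _ hs ht, Nat.add_le_add hsN htN⟩

theorem comap {κ : Type} {V : T → κ → K} (h : Feasible w X Y N) (ρ : ι → κ)
    (hρ : ∀ τ i, X τ i = V τ (ρ i)) : Feasible w V Y N := by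
  obtain ⟨P, hP⟩ := h
  refine ⟨P.rename ρ, fun τ => ?_⟩
  obtain ⟨t, ht, htN⟩ := hP τ
  refine ⟨t, ?_, htN⟩
  rw [P.run_rename, show V τ ∘ ρ = X τ from funext fun i => (hρ τ i).symm, ht]

theorem comp (hY : Feasible w X Y N) (hZ : Feasible w Y Z N') : Feasible w X Z (N + N') :=
  hY.trans (hZ.comap Sum.inl fun _ _ => rfl)

theorem reindex (hY : Feasible w X Y N) (e : ω' → ω) :
    Feasible w X (fun τ o => Y τ (e o)) N :=
  hY.comp (select Y e)

theorem sumElim (hY : Feasible w X Y N) (hZ : Feasible w X Z N') :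
    Feasible w X (fun τ => Sum.elim (Y τ) (Z τ)) (N + N') := by
  have hZ' := hZ.comap (V := fun τ => Sum.elim (Y τ) (X τ)) Sum.inr fun _ _ => rfl
  refine (hY.trans (hZ'.trans (select _ (Sum.elim (fun i => .inr (.inl i)) .inl)))).congr ?_
  rintro τ (o | o) <;> rfl

theorem const (X : T → ι → K) (c : K) : Feasible w X (fun _ (_ : Unit) => c) 1 :=
  ⟨.const c (.halt fun _ => none), fun _ => ⟨1, rfl, le_rfl⟩⟩

theorem arith {a b c : T → K} (op : ArithOp)
    (ha : Feasible w X (fun τ (_ : Unit) => a τ) N)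
    (hb : Feasible w X (fun τ (_ : Unit) => b τ) N')
    (hc : ∀ τ, op.eval (a τ) (b τ) = some (c τ)) :
    Feasible w X (fun τ (_ : Unit) => c τ) (N + N' + 1) := by
  refine (ha.sumElim hb).comp ⟨.arith op (.inl ()) (.inr ()) (.halt fun _ => none), fun τ => ?_⟩
  refine ⟨1, ?_, le_rfl⟩
  simp [Program.run, hc, extend]

theorem of_forall {m c : ℕ} {Y : T → Fin m → K}
    (h : ∀ k, Feasible w X (fun τ (_ : Unit) => Y τ k) c) : Feasible w X Y (m * c) := by
  induction m with
  | zero => exact ((select X (Fin.elim0 : Fin 0 → ι)).congr fun _ o => o.elim0).mono (Nat.zero_le _)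
  | succ m ih =>
    have ht := ih (Y := fun τ k => Y τ k.succ) fun k => h k.succ
    refine ((((h 0).sumElim ht).reindex
      (Fin.cases (.inl ()) .inr : Fin (m + 1) → Unit ⊕ Fin m)).congr fun τ o => ?_).mono
      (le_of_eq (by ring))
    cases o using Fin.cases <;> rfl

/-- The coefficients of a product. -/
theorem polyMul {M : ℕ → ℕ} (hM : IsMulCost K M) {n : ℕ} {a b : T → K[X]}
    (ha : ∀ τ, (a τ).natDegree ≤ n) (hb : ∀ τ, (b τ).natDegree ≤ n)
    (hfa : Feasible w X (fun τ (i : Fin (n + 1)) => (a τ).coeff i) N)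
    (hfb : Feasible w X (fun τ (i : Fin (n + 1)) => (b τ).coeff i) N') :
    Feasible w X (fun τ (k : Fin (2 * n + 1)) => (a τ * b τ).coeff k) (N + N' + M n) := by
  obtain ⟨P, hP, hmul⟩ := hM n
  refine (hfa.sumElim hfb).comp ⟨P, fun τ => ?_⟩
  obtain ⟨t, ht, htM⟩ := hmul (a τ) (b τ) (ha τ) (hb τ)
  exact ⟨t, by rw [hP.run_eq w 0, ht], htM⟩

theorem polyDerivative {n : ℕ} {a : T → K[X]} (ha : ∀ τ, (a τ).natDegree ≤ n)
    (hfa : Feasible w X (fun τ (i : Fin (n + 1)) => (a τ).coeff i) N) :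
    Feasible w X (fun τ (i : Fin (n + 1)) => (derivative (a τ)).coeff i) (N + (n + 1) * 2) := by
  refine hfa.comp (of_forall fun k => ?_)
  by_cases hk : (k : ℕ) < n
  · refine arith .mul (entry (⟨k + 1, by omega⟩ : Fin (n + 1)))
      (const _ ((k : ℕ) + 1 : K)) fun τ => ?_
    rw [coeff_derivative]; rfl
  · refine ((const _ 0).mono one_le_two).congr fun τ _ => ?_
    rw [coeff_derivative, coeff_eq_zero_of_natDegree_lt (lt_of_le_of_lt (ha τ) (by omega)), zero_mul]

/-- The coefficients of the Wronskian of two polynomials. -/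
theorem polyWronskian {M : ℕ → ℕ} (hM : IsMulCost K M) {n : ℕ} {a b : T → K[X]}
    (ha : ∀ τ, (a τ).natDegree ≤ n) (hb : ∀ τ, (b τ).natDegree ≤ n)
    (hfa : Feasible w X (fun τ (i : Fin (n + 1)) => (a τ).coeff i) N)
    (hfb : Feasible w X (fun τ (i : Fin (n + 1)) => (b τ).coeff i) N') :
    Feasible w X
      (fun τ (k : Fin (2 * n)) =>
        (derivative (a τ) * b τ - a τ * derivative (b τ)).coeff k)
      (2 * N + 2 * N' + 9 * M n) := by
  have hn := hM.two_mul_add_one_le n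
  have hder : ∀ p : K[X], p.natDegree ≤ n → (derivative p).natDegree ≤ n := fun p hp =>
    (natDegree_derivative_le p).trans (by omega)
  have h₁ := (hfa.polyDerivative ha).polyMul hM (fun τ => hder _ (ha τ)) hb hfb
  have h₂ := hfa.polyMul hM ha (fun τ => hder _ (hb τ)) (hfb.polyDerivative hb)
  -- Besides two products, the derivatives and the subtraction cost `6 n + 4` operations, at most `4
  -- M n`.
  refine ((h₁.sumElim h₂).comp (of_forall (c := 1) fun k => ?_)).mono
    (N' := 2 * N + 2 * N' + 9 * M n) (by omega)
  have hk : (k : ℕ) < 2 * n + 1 := by omega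
  refine arith .sub (entry (Sum.inl ⟨k, hk⟩)) (entry (Sum.inr ⟨k, hk⟩)) fun τ => ?_
  rw [coeff_sub]; rfl

/-- The coefficients of the representative of degree less than `n` of `b / x` modulo `a`. -/
theorem polyDivX {n : ℕ} {a b : T → K[X]}
    (ha : ∀ τ, (a τ).natDegree ≤ n) (hb : ∀ τ, (b τ).natDegree ≤ n)
    (ha0 : ∀ τ, (a τ).coeff 0 ≠ 0)
    (hfa : Feasible w X (fun τ (i : Fin (n + 1)) => (a τ).coeff i) N)
    (hfb : Feasible w X (fun τ (i : Fin (n + 1)) => (b τ).coeff i) N') :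
    Feasible w X
      (fun τ (i : Fin (n + 1)) =>
        (divX (b τ) - C ((b τ).coeff 0 / (a τ).coeff 0) * divX (a τ)).coeff i)
      (N + N' + (n + 1) * 3) := by
  refine (hfa.sumElim hfb).comp (of_forall fun k => ?_)
  simp only [coeff_sub, coeff_C_mul, coeff_divX]
  by_cases hk : (k : ℕ) < n
  · have hk' : (k : ℕ) + 1 < n + 1 := by omega
    -- The quotient of the constant terms is recomputed for every coefficient; the total stays
    -- linear.
    refine arith (N := 0) (N' := 2) .sub (entry (Sum.inr ⟨k + 1, hk'⟩))
      (arith (N := 1) (N' := 0) .mul (arith (N := 0) (N' := 0) .div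
        (c := fun τ => (b τ).coeff 0 / (a τ).coeff 0)
        (entry (Sum.inr 0)) (entry (Sum.inl 0)) fun τ => ?_)
        (entry (Sum.inl ⟨k + 1, hk'⟩)) fun τ => rfl) fun τ => rfl
    simp [ArithOp.eval, ha0]
  · refine ((const _ 0).mono (N' := 3) (by omega)).congr fun τ _ => ?_
    rw [coeff_eq_zero_of_natDegree_lt (p := a τ) (n := k + 1) (lt_of_le_of_lt (ha τ) (by omega)),
      coeff_eq_zero_of_natDegree_lt (p := b τ) (n := k + 1) (lt_of_le_of_lt (hb τ) (by omega)), mul_zero,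
      sub_zero]

end Feasible
end Programs

/-! ### Polar parts, Bezoutians and inverses of Hankel matrices. -/

section Algebra

variable {K : Type u} [Field K]

theorem coeff_iterate_divX (p : K[X]) (k j : ℕ) : (divX^[k] p).coeff j = p.coeff (j + k) := by
  induction k generalizing j with
  | zero => rfl
  | succ k ih => rw [Function.iterate_succ_apply', coeff_divX, ih]; congr 1; omega

theorem X_mul_iterate_divX_succ (p : K[X]) (k : ℕ) :
    X * divX^[k + 1] p = divX^[k] p - C (p.coeff k) := by
  rw [Function.iterate_succ_apply', eq_sub_iff_add_eq]
  convert X_mul_divX_add (divX^[k] p) using 3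
  rw [coeff_iterate_divX, zero_add]

theorem iterate_divX_eq_zero {p : K[X]} {k : ℕ} (h : p.natDegree < k) : divX^[k] p = 0 := by
  ext j
  rw [coeff_iterate_divX, coeff_zero, coeff_eq_zero_of_natDegree_lt (by omega)]

/-- The term of index `k` contributes `p_{m+1}` to the coefficient of `x ^ m` exactly when `k ≤ m`,
hence `m + 1` times in all. This is the source of the derivatives in the Wronskian. -/
theorem sum_iterate_divX_mul_X_pow {p : K[X]} {n : ℕ} (h : p.natDegree ≤ n) :
    ∑ k ∈ Finset.range n, divX^[k + 1] p * X ^ k = derivative p := by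
  ext m
  simp only [finsetSum_coeff, coeff_mul_X_pow', coeff_iterate_divX, coeff_derivative]
  rw [Finset.sum_congr rfl (g := fun k => if k ≤ m then p.coeff (m + 1) else 0)
    fun k _ => by split_ifs with hk; · congr 1; omega
                  · rfl]
  rw [← Finset.sum_filter, Finset.sum_const]
  by_cases hm : m < n
  · have : (Finset.range n).filter (· ≤ m) = Finset.range (m + 1) := by
      ext k; simp only [Finset.mem_filter, Finset.mem_range]; omega
    rw [this, Finset.card_range, nsmul_eq_mul]; push_cast; ring
  · rw [coeff_eq_zero_of_natDegree_lt (by omega)]; simp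

/-- For a linear form `ℓ` with generating series `∑ ℓ (x ^ i) x ^ (-i - 1)`, which is to be
annihilated by `f`, the polynomial part of `f` times the generating series of `ℓ (p ·)`. -/
noncomputable def polarPart (ℓ : K[X] →ₗ[K] K) (f p : K[X]) : K[X] :=
  ∑ k ∈ Finset.range f.natDegree, monomial k (ℓ (p * divX^[k + 1] f))

theorem coeff_polarPart (ℓ : K[X] →ₗ[K] K) (f p : K[X]) (k : ℕ) :
    (polarPart ℓ f p).coeff k = ℓ (p * divX^[k + 1] f) := by
  simp only [polarPart, finsetSum_coeff, coeff_monomial, Finset.sum_ite_eq', Finset.mem_range]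
  split_ifs with h
  · rfl
  · rw [iterate_divX_eq_zero (by omega), mul_zero, map_zero]

theorem degree_polarPart_lt (ℓ : K[X] →ₗ[K] K) (f p : K[X]) (hf : f ≠ 0) :
    (polarPart ℓ f p).degree < f.degree := by
  rw [degree_eq_natDegree hf, degree_lt_iff_coeff_zero]
  intro m hm
  rw [coeff_polarPart, iterate_divX_eq_zero (by omega), mul_zero, map_zero]

/-- Shifting a sequence multiplies its generating series in `1/x` by `x` and drops the leading term
`ℓ p`; multiply this by `f`. -/
theorem polarPart_X_mul {ℓ : K[X] →ₗ[K] K} {f : K[X]} (hℓ : ∀ p, ℓ (p * f) = 0) (p : K[X]) :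
    polarPart ℓ f (X * p) = X * polarPart ℓ f p - C (ℓ p) * f := by
  ext k
  rw [coeff_sub, coeff_C_mul, coeff_polarPart,
    show X * p * divX^[k + 1] f = p * divX^[k] f - f.coeff k • p by
      rw [mul_comm X p, mul_assoc, X_mul_iterate_divX_succ, smul_eq_C_mul]; ring,
    map_sub, map_smul, smul_eq_mul, mul_comm (f.coeff k)]
  congr 1
  cases k with
  | zero => rw [coeff_X_mul_zero]; exact hℓ p
  | succ k => rw [coeff_X_mul, coeff_polarPart]

/-- Modulo `f` the polar part is `K`-linear in `p` and commutes with multiplication by `x`, hence is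
`K[x]`-linear. -/
theorem dvd_polarPart_sub {ℓ : K[X] →ₗ[K] K} {f : K[X]} (hℓ : ∀ p, ℓ (p * f) = 0) (p : K[X]) :
    f ∣ polarPart ℓ f p - p * polarPart ℓ f 1 := by
  have hC : ∀ a, polarPart ℓ f (C a) = C a * polarPart ℓ f 1 := by
    intro a; ext k
    rw [coeff_C_mul, coeff_polarPart, coeff_polarPart, one_mul, ← smul_eq_C_mul, map_smul,
      smul_eq_mul]
  induction p using Polynomial.induction_on with
  | C a => rw [hC, sub_self]; exact dvd_zero f
  | add p q hp hq =>
    have : polarPart ℓ f (p + q) = polarPart ℓ f p + polarPart ℓ f q := by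
      ext k; simp only [coeff_add, coeff_polarPart, add_mul, map_add]
    rw [this]; convert dvd_add hp hq using 1; ring
  | monomial n a h =>
    rw [show C a * X ^ (n + 1) = X * (C a * X ^ n) by ring, polarPart_X_mul hℓ]
    convert dvd_sub (h.mul_left X) (dvd_mul_left f (C (ℓ (C a * X ^ n)))) using 1; ring

/-- The columns of the Bezoutian of `f` and `q`, preceded by a zero column. -/
noncomputable def bezoutCol (f q : K[X]) (k : ℕ) : K[X] :=
  q * divX^[k] f - f * divX^[k] q

/-- Induction on `k`: `x` times the next column is the current one plus a combination of `f` and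
`q`, so it has degree at most `n`. -/
theorem coeff_bezoutCol_eq_zero {f q : K[X]} {n : ℕ} (hf : f.natDegree ≤ n)
    (hq : q.natDegree ≤ n) (k : ℕ) : ∀ j, n ≤ j → (bezoutCol f q k).coeff j = 0 := by
  induction k with
  | zero => intro j _; simp [bezoutCol, mul_comm]
  | succ k ih =>
    intro j hj
    have h : X * bezoutCol f q (k + 1) =
        bezoutCol f q k - C (f.coeff k) * q + C (q.coeff k) * f := by
      rw [bezoutCol, mul_sub, mul_left_comm, X_mul_iterate_divX_succ, mul_left_comm,
        X_mul_iterate_divX_succ, bezoutCol]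
      ring
    rw [← coeff_X_mul, h, coeff_add, coeff_sub, coeff_C_mul, coeff_C_mul, ih _ (by omega),
      coeff_eq_zero_of_natDegree_lt (p := f) (n := j + 1) (by omega),
      coeff_eq_zero_of_natDegree_lt (p := q) (n := j + 1) (by omega)]
    ring

theorem sum_hankel_mul_coeff (ℓ : K[X] →ₗ[K] K) {n : ℕ} {p : K[X]}
    (hp : ∀ j, n ≤ j → p.coeff j = 0) (i : ℕ) :
    ∑ j : Fin n, ℓ (X ^ (i + (j : ℕ))) * p.coeff j = ℓ (X ^ i * p) := by
  have hs : p = ∑ j : Fin n, monomial j (p.coeff j) := by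
    ext m
    rw [finsetSum_coeff, Fin.sum_univ_eq_sum_range (fun j => (monomial j (p.coeff j)).coeff m)]
    simp only [coeff_monomial, Finset.sum_ite_eq', Finset.mem_range]
    split_ifs with h
    · rfl
    · exact hp m (by omega)
  conv_rhs => rw [hs, Finset.mul_sum, map_sum]
  refine Finset.sum_congr rfl fun j _ => ?_
  rw [← C_mul_X_pow_eq_monomial, mul_left_comm, ← pow_add, ← smul_eq_C_mul, map_smul,
    smul_eq_mul, mul_comm]

/-- The inverse of a Hankel matrix is a Bezoutian. -/
theorem inv_hankel {ℓ : K[X] →ₗ[K] K} {f q : K[X]} {n : ℕ} (hf : f.Monic) (hn : f.natDegree = n)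
    (hℓ : ∀ p, ℓ (p * f) = 0) (hq : q.natDegree ≤ n) (hinv : f ∣ q * polarPart ℓ f 1 - 1) :
    (hankel n fun k => ℓ (X ^ k))⁻¹ =
      Matrix.of fun j k : Fin n => (bezoutCol f q (k + 1)).coeff j := by
  refine Matrix.inv_eq_right_inv ?_
  ext i k
  -- Both sides have degree less than `n` and are congruent to `x ^ i q g` modulo `f`.
  have hres : polarPart ℓ f (X ^ (i : ℕ) * q) = X ^ (i : ℕ) := by
    rw [← sub_eq_zero]
    refine eq_zero_of_dvd_of_degree_lt (p := f) ?_ ?_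
    · convert dvd_add (dvd_polarPart_sub hℓ (X ^ (i : ℕ) * q)) (hinv.mul_left (X ^ (i : ℕ))) using 1
      ring
    · refine lt_of_le_of_lt (degree_sub_le _ _) (max_lt (degree_polarPart_lt ℓ f _ hf.ne_zero) ?_)
      rw [degree_X_pow, degree_eq_natDegree hf.ne_zero, hn]
      exact_mod_cast i.2
  simp only [Matrix.mul_apply, hankel, Matrix.of_apply]
  -- The product entry is `ℓ` of `x ^ i` times column `k`. The multiple of `f` is killed, and what
  -- remains is the coefficient of `x ^ k` in the polar part of `x ^ i q`.
  rw [sum_hankel_mul_coeff ℓ (coeff_bezoutCol_eq_zero hn.le hq _), bezoutCol, mul_sub, map_sub,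
    show X ^ (i : ℕ) * (f * divX^[(k : ℕ) + 1] q) = X ^ (i : ℕ) * divX^[(k : ℕ) + 1] q * f by ring,
    hℓ, sub_zero, ← mul_assoc, ← coeff_polarPart, hres, coeff_X_pow, Matrix.one_apply]
  simp only [Fin.ext_iff, eq_comm]

/-- Weighting column `k` by `x ^ k` and summing collects the anti-diagonals of the Bezoutian into
one polynomial, which is the Wronskian by `sum_iterate_divX_mul_X_pow`. -/
theorem antidiagSum_inv_hankel {ℓ : K[X] →ₗ[K] K} {f q : K[X]} {n : ℕ} (hf : f.Monic)
    (hn : f.natDegree = n) (hℓ : ∀ p, ℓ (p * f) = 0) (hq : q.natDegree ≤ n)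
    (hinv : f ∣ q * polarPart ℓ f 1 - 1) (m : ℕ) :
    antidiagSum (hankel n fun k => ℓ (X ^ k))⁻¹ m =
      (derivative f * q - f * derivative q).coeff m := by
  have h : derivative f * q - f * derivative q =
      ∑ k ∈ Finset.range n, bezoutCol f q (k + 1) * X ^ k := by
    simp only [bezoutCol, sub_mul, Finset.sum_sub_distrib, mul_assoc, ← Finset.mul_sum,
      sum_iterate_divX_mul_X_pow hn.le, sum_iterate_divX_mul_X_pow hq]
    ring
  rw [h, inv_hankel hf hn hℓ hq hinv, antidiagSum, Finset.sum_comm, finsetSum_coeff,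
    Finset.sum_range]
  refine Finset.sum_congr rfl fun k _ => ?_
  simp only [Matrix.of_apply]
  rw [Fin.sum_univ_eq_sum_range
    (fun i => if i + (k : ℕ) = m then (bezoutCol f q (k + 1)).coeff i else 0), coeff_mul_X_pow']
  split_ifs with hk
  · rw [Finset.sum_congr rfl (g := fun i => if i = m - k then (bezoutCol f q (k + 1)).coeff i else 0)
      fun i _ => if_congr (by omega) rfl rfl, Finset.sum_ite_eq']
    split_ifs with hm
    · rfl
    · rw [coeff_bezoutCol_eq_zero hn.le hq _ _ (by simpa using hm)]
  · exact Finset.sum_eq_zero fun i _ => if_neg (by omega)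

/-- A polynomial of degree less than `n` orthogonal to `1, …, x ^ (n - 1)` vanishes if the Hankel
matrix is non-singular. -/
theorem eq_zero_of_hankel_det_ne_zero {ℓ : K[X] →ₗ[K] K} {n : ℕ}
    (hdet : (hankel n fun k => ℓ (X ^ k)).det ≠ 0) {p : K[X]} (hp : ∀ j, n ≤ j → p.coeff j = 0)
    (h : ∀ i < n, ℓ (X ^ i * p) = 0) : p = 0 := by
  have hv : (fun j : Fin n => p.coeff j) = 0 := by
    refine Matrix.eq_zero_of_mulVec_eq_zero hdet ?_
    ext i
    rw [Pi.zero_apply, ← h i i.2, ← sum_hankel_mul_coeff ℓ hp i]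
    rfl
  ext j
  by_cases hj : j < n
  · exact congrFun hv ⟨j, hj⟩
  · exact hp j (by omega)

/-- Column `m` of the inverse Hankel matrix is the coefficient vector of `q`. -/
theorem exists_hankel_dual {ℓ : K[X] →ₗ[K] K} {n : ℕ}
    (hdet : (hankel n fun k => ℓ (X ^ k)).det ≠ 0) (m : Fin n) :
    ∃ q : K[X], (∀ j, n ≤ j → q.coeff j = 0) ∧
      ∀ p : K[X], (∀ j, n ≤ j → p.coeff j = 0) → ℓ (q * p) = p.coeff m := by
  set H := hankel n fun k => ℓ (X ^ k) with hH
  set r := H⁻¹.mulVec (Pi.single m 1) with hr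
  have hHr : H.mulVec r = Pi.single m 1 := by
    rw [hr, Matrix.mulVec_mulVec, Matrix.mul_nonsing_inv _ (isUnit_iff_ne_zero.2 hdet),
      Matrix.one_mulVec]
  have hcoeff : ∀ j : Fin n, (∑ j : Fin n, monomial (j : ℕ) (r j)).coeff j = r j := by
    intro j
    simp only [finsetSum_coeff, coeff_monomial, Fin.val_inj, Finset.sum_ite_eq', Finset.mem_univ,
      if_true]
  have hzero : ∀ j, n ≤ j → (∑ j : Fin n, monomial (j : ℕ) (r j)).coeff j = 0 := by
    intro j hj
    rw [finsetSum_coeff]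
    exact Finset.sum_eq_zero fun i _ => by rw [coeff_monomial, if_neg (by omega)]
  refine ⟨∑ j : Fin n, monomial (j : ℕ) (r j), hzero, fun p hp => ?_⟩
  set q := ∑ j : Fin n, monomial (j : ℕ) (r j)
  have hq : ∀ i : Fin n, ℓ (X ^ (i : ℕ) * q) = (Pi.single m 1 : Fin n → K) i := by
    intro i
    rw [← sum_hankel_mul_coeff ℓ hzero, ← hHr]
    exact Finset.sum_congr rfl fun j _ => by rw [hcoeff]; rfl
  have := sum_hankel_mul_coeff (ℓ ∘ₗ LinearMap.mulLeft K q) hp 0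
  simp only [LinearMap.comp_apply, LinearMap.mulLeft_apply, zero_add, pow_zero, one_mul] at this
  rw [← this]
  simp only [mul_comm q, hq, Pi.single_apply, ite_mul, one_mul, zero_mul, Finset.sum_ite_eq',
    Finset.mem_univ, if_true]

/-- Take `q` such that `ℓ (q ·)` reads off the coefficient of `x ^ (n - 1)` in degree less than `n`.
The polar part of `q` then has coefficients `f_{n+k}`, so it is 1, and `q` inverts `polarPart ℓ f 1`
modulo `f`. -/
theorem isCoprime_polarPart {ℓ : K[X] →ₗ[K] K} {f : K[X]} {n : ℕ} (hn0 : 0 < n) (hf : f.Monic)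
    (hn : f.natDegree = n) (hℓ : ∀ p, ℓ (p * f) = 0)
    (hdet : (hankel n fun k => ℓ (X ^ k)).det ≠ 0) : IsCoprime f (polarPart ℓ f 1) := by
  obtain ⟨q, -, hq⟩ := exists_hankel_dual hdet ⟨n - 1, by omega⟩
  have h1 : polarPart ℓ f q = 1 := by
    ext k
    rw [coeff_polarPart, hq, coeff_iterate_divX, coeff_one]
    · split_ifs with hk
      · rw [hk, show n - 1 + (0 + 1) = f.natDegree by omega]; exact hf
      · exact coeff_eq_zero_of_natDegree_lt (show f.natDegree < n - 1 + (k + 1) by omega)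
    · intro j hj
      rw [coeff_iterate_divX]
      exact coeff_eq_zero_of_natDegree_lt (by omega)
  obtain ⟨c, hc⟩ := dvd_polarPart_sub hℓ q
  exact ⟨c, q, by rw [mul_comm c, ← hc, h1]; ring⟩

/-! ### The Krylov sequence, its minimum polynomial, and inversion modulo it. -/

/-- The linear form `p ↦ u p(A) v`. -/
noncomputable def krylovForm {n : ℕ} (A : Matrix (Fin n) (Fin n) K) (u v : Fin n → K) :
    K[X] →ₗ[K] K where
  toFun p := dotProduct u (Matrix.mulVec (aeval A p) v)
  map_add' p q := by rw [map_add, Matrix.add_mulVec, dotProduct_add]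
  map_smul' c p := by rw [map_smul, Matrix.smul_mulVec, dotProduct_smul, RingHom.id_apply]

theorem krylovForm_X_pow {n : ℕ} (A : Matrix (Fin n) (Fin n) K) (u v : Fin n → K) (k : ℕ) :
    krylovForm A u v (X ^ k) = krylovSeq A u v k := by
  simp [krylovForm, krylovSeq]

theorem krylovForm_mul_charpoly {n : ℕ} (A : Matrix (Fin n) (Fin n) K) (u v : Fin n → K)
    (p : K[X]) : krylovForm A u v (p * A.charpoly) = 0 := by
  simp [krylovForm, Matrix.aeval_self_charpoly]

theorem krylovForm_X_pow_mul {n : ℕ} (A : Matrix (Fin n) (Fin n) K) (u v : Fin n → K)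
    (i : ℕ) (p : K[X]) : krylovForm A u v (X ^ i * p) =
      ∑ j ∈ Finset.range (p.natDegree + 1), p.coeff j * krylovSeq A u v (i + j) := by
  rw [← sum_hankel_mul_coeff _ (n := p.natDegree + 1)
    fun j hj => coeff_eq_zero_of_natDegree_lt hj, Finset.sum_range]
  exact Finset.sum_congr rfl fun j _ => by rw [krylovForm_X_pow, mul_comm]

/-- The characteristic polynomial generates the sequence, so `f` has degree at most `n`. As `f` is
orthogonal to `1, …, x ^ (n - 1)`, non-singularity excludes a smaller degree, and then kills the
difference of the two monic polynomials. -/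
theorem IsSeqMinpoly.eq_charpoly {n : ℕ} {A : Matrix (Fin n) (Fin n) K} {u v : Fin n → K}
    {f : K[X]} (hf : IsSeqMinpoly (krylovSeq A u v) (2 * n) f)
    (hdet : (hankel n (krylovSeq A u v)).det ≠ 0) : f = A.charpoly := by
  have hdeg : A.charpoly.natDegree = n := by simp
  have hle : f.natDegree ≤ n := by
    rw [← hdeg]
    refine hf.minimal _ A.charpoly_monic fun i _ => ?_
    rw [← krylovForm_X_pow_mul, krylovForm_mul_charpoly]
  have hker : ∀ i < n, krylovForm A u v (X ^ i * f) = 0 := fun i hi => by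
    rw [krylovForm_X_pow_mul]; exact hf.generates i (by omega)
  have hdet' : (hankel n fun k => krylovForm A u v (X ^ k)).det ≠ 0 := by
    simpa only [krylovForm_X_pow] using hdet
  have hn : f.natDegree = n := by
    by_contra hne
    exact hf.monic.ne_zero (eq_zero_of_hankel_det_ne_zero hdet'
      (fun j hj => coeff_eq_zero_of_natDegree_lt (by omega)) hker)
  rw [← sub_eq_zero]
  refine eq_zero_of_hankel_det_ne_zero hdet' (fun j hj => ?_) fun i hi => ?_
  · rcases hj.eq_or_lt with hj | hj
    · have h1 := hf.monic.coeff_natDegree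
      have h2 := A.charpoly_monic.coeff_natDegree
      rw [hn] at h1
      rw [hdeg] at h2
      rw [← hj, coeff_sub, h1, h2, sub_self]
    · rw [coeff_sub, coeff_eq_zero_of_natDegree_lt (by omega),
        coeff_eq_zero_of_natDegree_lt (by omega), sub_zero]
  · rw [mul_sub, map_sub, hker i hi, krylovForm_mul_charpoly, sub_zero]

theorem coeff_zero_charpoly_ne_zero {n : ℕ} {A : Matrix (Fin n) (Fin n) K} (hA : A.det ≠ 0) :
    A.charpoly.coeff 0 ≠ 0 := by
  intro h
  rw [Matrix.det_eq_sign_charpoly_coeff, h, mul_zero] at hA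
  exact hA rfl

/-- The coefficients of the polar part as coefficients of a product. -/
theorem coeff_polarPart_one (ℓ : K[X] →ₗ[K] K) {f : K[X]} {n : ℕ} (hn : f.natDegree = n) (k : ℕ) :
    (polarPart ℓ f 1).coeff k =
      (f * ∑ i ∈ Finset.range n, monomial (n - 1 - i) (ℓ (X ^ i))).coeff (n + k) := by
  rw [coeff_polarPart, one_mul, Finset.mul_sum, finsetSum_coeff, Finset.sum_range]
  have h := sum_hankel_mul_coeff ℓ (n := n) (p := divX^[k + 1] f) (fun j hj => by
    rw [coeff_iterate_divX]; exact coeff_eq_zero_of_natDegree_lt (by omega)) 0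
  rw [pow_zero, one_mul] at h
  rw [← h]
  refine Finset.sum_congr rfl fun i _ => ?_
  rw [← C_mul_X_pow_eq_monomial, ← mul_assoc, coeff_mul_X_pow', if_pos (by omega), coeff_mul_C,
    coeff_iterate_divX, zero_add, mul_comm]
  congr 2
  have := i.2
  omega

/-- The shifted sequence: if `q` inverts the polar part of `ℓ` modulo `f`, then `q / x` inverts
the polar part of `ℓ (x ·)`. -/
theorem dvd_divX_mul_polarPart_sub_one {ℓ : K[X] →ₗ[K] K} {f q : K[X]}
    (hℓ : ∀ p, ℓ (p * f) = 0) (h0 : f.coeff 0 ≠ 0) (hinv : f ∣ q * polarPart ℓ f 1 - 1) :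
    f ∣ (divX q - C (q.coeff 0 / f.coeff 0) * divX f) *
      polarPart (ℓ ∘ₗ LinearMap.mulLeft K X) f 1 - 1 := by
  set c := q.coeff 0 / f.coeff 0 with hc
  have hX : X * (divX q - C c * divX f) = q - C c * f := by
    conv_rhs => rw [← X_mul_divX_add q, ← X_mul_divX_add f]
    have : C (q.coeff 0) = C c * C (f.coeff 0) := by rw [← C_mul, hc, div_mul_cancel₀ _ h0]
    rw [this]; ring
  -- Hence the shifted polar part is `x` times the original one modulo `f`, and the factor `x`
  -- cancels by `hX`.
  have hpol : polarPart (ℓ ∘ₗ LinearMap.mulLeft K X) f 1 = polarPart ℓ f X := by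
    ext k
    simp [coeff_polarPart]
  obtain ⟨a, ha⟩ := dvd_polarPart_sub hℓ X
  obtain ⟨b, hb⟩ := hinv
  rw [hpol, sub_eq_iff_eq_add.1 ha]
  refine ⟨(divX q - C c * divX f) * a + b - C c * polarPart ℓ f 1, ?_⟩
  linear_combination (polarPart ℓ f 1) * hX + hb

/-- An extended gcd of `x ^ n f` and `x ^ n g`, with `f` and `g` coprime, yields the inverse of `g`
modulo `f`. -/
theorem IsExtGcd.inverse {f g d s t : K[X]} {n : ℕ} (hn0 : 0 < n) (hf : f.Monic)
    (hn : f.natDegree = n) (hfg : IsCoprime f g) (h : IsExtGcd (X ^ n * f) (X ^ n * g) d s t) :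
    d.coeff n ≠ 0 ∧ t.natDegree < n ∧ f ∣ C (d.coeff n)⁻¹ * t * g - 1 := by
  have hd : d = X ^ n * (s * f + t * g) := by rw [← h.bezout]; ring
  -- Coprimality gives `d ∣ x ^ n`, while `d` is `x ^ n` times this factor.
  have hu : IsUnit (s * f + t * g) := by
    obtain ⟨a, b, hab⟩ := hfg
    have : d ∣ X ^ n := by
      convert dvd_add (h.dvd_left.mul_left a) (h.dvd_right.mul_left b) using 1
      linear_combination (-X ^ n) * hab
    rw [hd] at this
    obtain ⟨e, he⟩ := this
    refine IsUnit.of_mul_eq_one e (mul_left_cancel₀ (pow_ne_zero n (X_ne_zero (R := K))) ?_)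
    rw [mul_one, ← mul_assoc, ← he]
  obtain ⟨c, hc, hcs⟩ := Polynomial.isUnit_iff.1 hu
  rw [← hcs] at hd
  have hcn : d.coeff n = c := by rw [hd, coeff_X_pow_mul', if_pos le_rfl]; simp
  have hdeg : d.natDegree = n := by rw [hd, mul_comm, natDegree_C_mul_X_pow n c hc.ne_zero]
  have hfd : (X ^ n * f).natDegree = 2 * n := by
    rw [(monic_X_pow n).natDegree_mul hf, natDegree_X_pow, hn]; ring
  rw [hcn]
  refine ⟨hc.ne_zero, ?_, ⟨-(C c⁻¹ * s), ?_⟩⟩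
  -- The bound reads `max 1 (2 n - n)`, which is `n` because `n` is positive.
  · have := h.degree_right
    rw [hfd, hdeg] at this
    omega
  · have hcc : C c⁻¹ * C c = 1 := by rw [← C_mul, inv_mul_cancel₀ hc.ne_zero, C_1]
    linear_combination hcc - C c⁻¹ * hcs

end Algebra

/-! ### Cost of the modular inverse and of the polar part. -/

section Costs

variable {K : Type u} [Field K] {w : ℕ} {T : Sort*} {ι : Type} {X : T → ι → K} {N N' : ℕ}

theorem Feasible.polyShift {n m : ℕ} {a : T → K[X]} (ha : ∀ τ, (a τ).natDegree < m)
    (hfa : Feasible w X (fun τ (i : Fin m) => (a τ).coeff i) N) :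
    Feasible w X (fun τ (i : Fin (2 * n + 1)) => (Polynomial.X ^ n * a τ).coeff i)
      (N + (2 * n + 1)) := by
  refine (hfa.comp (Feasible.of_forall (c := 1) fun k => ?_)).mono (by omega)
  by_cases hk : n ≤ (k : ℕ) ∧ (k : ℕ) - n < m
  · refine ((Feasible.entry (⟨k - n, hk.2⟩ : Fin m)).mono (Nat.zero_le 1)).congr fun τ _ => ?_
    rw [coeff_X_pow_mul', if_pos hk.1]
  · refine (Feasible.const _ 0).congr fun τ _ => ?_
    rw [coeff_X_pow_mul']
    split_ifs with h
    · exact (coeff_eq_zero_of_natDegree_lt (by have := ha τ; omega)).symm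
    · rfl

/-- Modular inversion by one extended gcd computation in degree `2 n`. -/
theorem Feasible.exists_modularInverse {G : ℕ → ℕ} (hG : IsExtGcdCost K w G) {n : ℕ} (hn0 : 0 < n)
    {f g : T → K[X]} (hf : ∀ τ, (f τ).Monic) (hn : ∀ τ, (f τ).natDegree = n)
    (hg : ∀ τ, (g τ).natDegree < n) (hfg : ∀ τ, IsCoprime (f τ) (g τ))
    (hff : Feasible w X (fun τ (i : Fin (n + 1)) => (f τ).coeff i) N)
    (hfeasg : Feasible w X (fun τ (i : Fin n) => (g τ).coeff i) N') :
    ∃ q : T → K[X], (∀ τ, (q τ).natDegree ≤ n ∧ f τ ∣ q τ * g τ - 1) ∧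
      Feasible w X (fun τ (i : Fin (n + 1)) => (q τ).coeff i)
        (N + N' + 2 * (2 * n + 1) + G n + (n + 1)) := by
  obtain ⟨P, hP⟩ := hG n
  have hadeg : ∀ τ, (Polynomial.X ^ n * f τ).degree = ((2 * n : ℕ) : WithBot ℕ) := by
    intro τ
    rw [degree_eq_natDegree ((monic_X_pow n).mul (hf τ)).ne_zero,
      (monic_X_pow n).natDegree_mul (hf τ), natDegree_X_pow, hn, two_mul]
  have hbdeg : ∀ τ, (Polynomial.X ^ n * g τ).degree < (Polynomial.X ^ n * f τ).degree := by
    intro τ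
    rw [hadeg]
    refine degree_lt_iff_coeff_zero _ _ |>.2 fun m hm => ?_
    rw [coeff_X_pow_mul', if_pos (by omega)]
    exact coeff_eq_zero_of_natDegree_lt (by have := hg τ; omega)
  choose d s t hdst hPc using fun τ => hP _ _ (hadeg τ) (hbdeg τ)
  have hinv := fun τ => (hdst τ).inverse hn0 (hf τ) (hn τ) (hfg τ)
  refine ⟨fun τ => C ((d τ).coeff n)⁻¹ * t τ, fun τ =>
    ⟨(natDegree_C_mul_le _ _).trans (hinv τ).2.1.le, (hinv τ).2.2⟩, ?_⟩
  have hin := (hff.polyShift (n := n) fun τ => by rw [hn]; omega).sumElim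
    (hfeasg.polyShift (n := n) hg)
  refine ((hin.comp ⟨P, hPc⟩).comp (Feasible.of_forall (c := 1) fun k => ?_)).mono
    (N' := N + N' + 2 * (2 * n + 1) + G n + (n + 1)) (by omega)
  have hn' : n < 2 * n + 1 := by omega
  have hk' : (k : ℕ) < 2 * n + 1 := by omega
  -- The computed gcd is a constant times `x ^ n`; dividing the cofactor by that constant normalises
  -- it.
  refine Feasible.arith .div (Feasible.entry (Sum.inr (Sum.inr ⟨k, hk'⟩)))
    (Feasible.entry (Sum.inl ⟨n, hn'⟩)) fun τ => ?_
  rw [coeff_C_mul, ← div_eq_inv_mul]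
  exact if_neg (hinv τ).1

/-- The coefficients of the polar part, from those of `f` and the first terms of the sequence. -/
theorem Feasible.polarPart {M : ℕ → ℕ} (hM : IsMulCost K M) {n : ℕ} (hn0 : 0 < n)
    {f : T → K[X]} {ℓ : T → K[X] →ₗ[K] K} (hn : ∀ τ, (f τ).natDegree = n)
    (hff : Feasible w X (fun τ (i : Fin (n + 1)) => (f τ).coeff i) N)
    (hfℓ : Feasible w X (fun τ (i : Fin n) => ℓ τ (Polynomial.X ^ (i : ℕ))) N') :
    Feasible w X (fun τ (k : Fin n) => (polarPart (ℓ τ) (f τ) 1).coeff k)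
      (N + N' + (n + 1) + M n) := by
  set r : T → K[X] :=
    fun τ => ∑ i ∈ Finset.range n, monomial (n - 1 - i) (ℓ τ (Polynomial.X ^ i)) with hr
  have hcoeff : ∀ τ m, (r τ).coeff m =
      if m < n then ℓ τ (Polynomial.X ^ (n - 1 - m)) else 0 := by
    intro τ m
    simp only [hr, finsetSum_coeff, coeff_monomial]
    split_ifs with hm
    · rw [Finset.sum_eq_single (n - 1 - m), if_pos (by omega)]
      · intro i hi hne
        rw [Finset.mem_range] at hi
        exact if_neg (by omega)
      · intro h
        exact absurd (Finset.mem_range.2 (by omega)) h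
    · exact Finset.sum_eq_zero fun i _ => if_neg (by omega)
  have hrdeg : ∀ τ, (r τ).natDegree ≤ n := fun τ =>
    natDegree_le_iff_coeff_eq_zero.2 fun m hm => by rw [hcoeff, if_neg (by omega)]
  have hfr : Feasible w X (fun τ (i : Fin (n + 1)) => (r τ).coeff i) (N' + (n + 1) * 1) := by
    refine hfℓ.comp (Feasible.of_forall fun k => ?_)
    by_cases hk : (k : ℕ) < n
    · have hk' : n - 1 - (k : ℕ) < n := by omega
      refine ((Feasible.entry (⟨n - 1 - k, hk'⟩ : Fin n)).mono (Nat.zero_le 1)).congr fun τ _ => ?_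
      rw [hcoeff, if_pos hk]
    · refine (Feasible.const _ 0).congr fun τ _ => ?_
      rw [hcoeff, if_neg hk]
  refine (((hff.polyMul hM (fun τ => (hn τ).le) hrdeg hfr).reindex
    (fun k : Fin n => (⟨n + k, by omega⟩ : Fin (2 * n + 1)))).congr fun τ k => ?_).mono (by omega)
  rw [coeff_polarPart_one _ (hn τ)]

end Costs

/-- The anti-diagonal sums of the inverses of the Hankel matrices of `ℓ` and `ℓ (x ·)`. -/
theorem feasible_antidiagSums {K : Type u} [Field K] {w : ℕ} {M G : ℕ → ℕ} (hM : IsMulCost K M)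
    (hG : IsExtGcdCost K w G) {n : ℕ} (hn0 : 0 < n) {T : Sort*} {ι : Type} {X : T → ι → K}
    {f : T → K[X]} {ℓ : T → K[X] →ₗ[K] K} (hf : ∀ τ, (f τ).Monic) (hn : ∀ τ, (f τ).natDegree = n)
    (hf0 : ∀ τ, (f τ).coeff 0 ≠ 0) (hℓ : ∀ τ p, ℓ τ (p * f τ) = 0)
    (hdet : ∀ τ, (hankel n fun k => ℓ τ (Polynomial.X ^ k)).det ≠ 0)
    (hff : Feasible w X (fun τ (i : Fin (n + 1)) => (f τ).coeff i) 0)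
    (hfℓ : Feasible w X (fun τ (i : Fin n) => ℓ τ (Polynomial.X ^ (i : ℕ))) 0) :
    Feasible w X
      (fun τ => Sum.elim
        (fun k : Fin (2 * n) => antidiagSum (hankel n fun k => ℓ τ (Polynomial.X ^ k))⁻¹ k)
        (fun k : Fin (2 * n) => antidiagSum (hankel n fun k => ℓ τ (Polynomial.X ^ (k + 1)))⁻¹ k))
      (G n + 50 * M n) := by
  have hMn := hM.two_mul_add_one_le n
  have hgdeg : ∀ τ, (polarPart (ℓ τ) (f τ) 1).natDegree < n := fun τ => by
    refine lt_of_le_of_lt (natDegree_le_iff_coeff_eq_zero.2 fun m hm => ?_)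
      (Nat.sub_lt hn0 one_pos)
    rw [coeff_polarPart, iterate_divX_eq_zero (by rw [hn]; omega), mul_zero, map_zero]
  obtain ⟨q, hq, hfq⟩ := Feasible.exists_modularInverse hG hn0 hf hn hgdeg
    (fun τ => isCoprime_polarPart hn0 (hf τ) (hn τ) (hℓ τ) (hdet τ)) hff
    (hff.polarPart hM hn0 hn hfℓ)
  have hf' := hff.comap (V := fun τ => Sum.elim (fun i : Fin (n + 1) => (q τ).coeff i) (X τ))
    Sum.inr fun _ _ => rfl
  have hq' := Feasible.select (w := w) (ω := Fin (n + 1))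
    (fun τ => Sum.elim (fun i : Fin (n + 1) => (q τ).coeff i) (X τ)) Sum.inl
  simp only [Sum.elim_inl] at hq'
  have hfn : ∀ τ, (f τ).natDegree ≤ n := fun τ => (hn τ).le
  have hqn : ∀ τ, (q τ).natDegree ≤ n := fun τ => (hq τ).1
  have hqA := hf'.polyDivX hfn hqn hf0 hq'
  have hqAn : ∀ τ, (divX (q τ) - C ((q τ).coeff 0 / (f τ).coeff 0) * divX (f τ)).natDegree ≤ n :=
    fun τ => natDegree_le_iff_coeff_eq_zero.2 fun m hm => by
      rw [coeff_sub, coeff_C_mul, coeff_divX, coeff_divX,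
        coeff_eq_zero_of_natDegree_lt (p := q τ) (n := m + 1) (by have := hqn τ; omega),
        coeff_eq_zero_of_natDegree_lt (p := f τ) (n := m + 1) (by have := hfn τ; omega),
        mul_zero, sub_zero]
  -- The bounds add up to `G n + 19 M n + 12 n + 10`, so 50 leaves ample room.
  refine ((hfq.trans ((hf'.polyWronskian hM hfn hqn hq').sumElim
    (hf'.polyWronskian hM hfn hqAn hqA))).congr fun τ o => ?_).mono
    (N' := G n + 50 * M n) (by omega)
  rcases o with k | k
  · exact (antidiagSum_inv_hankel (hf τ) (hn τ) (hℓ τ) (hqn τ) (hq τ).2 k).symm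
  · have hshift : (hankel n fun k => ℓ τ (Polynomial.X ^ (k + 1))) =
        hankel n fun k => (ℓ τ ∘ₗ LinearMap.mulLeft K Polynomial.X) (Polynomial.X ^ k) := by
      simp only [LinearMap.comp_apply, LinearMap.mulLeft_apply, pow_succ']
    rw [Sum.elim_inr, Sum.elim_inr, hshift]
    refine (antidiagSum_inv_hankel (hf τ) (hn τ) (fun p => ?_) (hqAn τ)
      (dvd_divX_mul_polarPart_sub_one (hℓ τ) (hf0 τ) (hq τ).2) k).symm
    rw [LinearMap.comp_apply, LinearMap.mulLeft_apply, ← mul_assoc]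
    exact hℓ τ _

end HankelSums

theorem mainTheorem2 :
    ∃ C : ℕ, ∀ (K : Type*) [Field K] (w : ℕ) (M G : ℕ → ℕ),
      HankelSums.IsMulCost K M → HankelSums.IsExtGcdCost K w G →
      ∀ n : ℕ,
        ∃ P : HankelSums.Program K (Fin (2 * n) ⊕ Fin (2 * n))
            (Fin (n + 1) ⊕ (Fin n × Fin n) ⊕ (Fin n × Fin n)),
          ∀ (A : Matrix (Fin n) (Fin n) K) (u v : Fin n → K) (h : ℕ → K)
            (H HA : Matrix (Fin n) (Fin n) K) (f : Polynomial K),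
            h = HankelSums.krylovSeq A u v →
            H = HankelSums.hankel n h →
            HA = HankelSums.hankel n (fun k => h (k + 1)) →
            H.det ≠ 0 → A.det ≠ 0 →
            HankelSums.IsSeqMinpoly h (2 * n) f →
            P.Computes w
              (Sum.elim (fun i => f.coeff i)
                (Sum.elim (fun ij => H ij.1 ij.2) (fun ij => HA ij.1 ij.2)))
              (Sum.elim (fun k => HankelSums.antidiagSum H⁻¹ k)
                (fun k => HankelSums.antidiagSum HA⁻¹ k))
              (G n + C * M n) := by
  refine ⟨50, fun K _ w M G hM hG n => ?_⟩
  open HankelSums in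
  rcases Nat.eq_zero_or_pos n with rfl | hn0
  · refine ⟨.halt (Sum.elim (fun k => k.elim0) fun k => k.elim0), ?_⟩
    intros
    refine ⟨0, ?_, Nat.zero_le _⟩
    rw [Program.run]
    congr 2
    funext o
    rcases o with o | o <;> exact o.elim0
  -- One program must serve all admissible triples `(A, u, v)`, so these form the index type of
  -- instances.
  let T := { τ : Matrix (Fin n) (Fin n) K × (Fin n → K) × (Fin n → K) //
    (hankel n (krylovSeq τ.1 τ.2.1 τ.2.2)).det ≠ 0 ∧ τ.1.det ≠ 0 }
  let ℓ : T → K[X] →ₗ[K] K := fun τ => krylovForm τ.1.1 τ.1.2.1 τ.1.2.2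
  let V : T → Fin (n + 1) ⊕ (Fin n × Fin n) ⊕ (Fin n × Fin n) → K := fun τ =>
    Sum.elim (fun i => τ.1.1.charpoly.coeff i)
      (Sum.elim (fun ij => hankel n (fun k => ℓ τ (X ^ k)) ij.1 ij.2)
        (fun ij => hankel n (fun k => ℓ τ (X ^ (k + 1))) ij.1 ij.2))
  have hfeas := feasible_antidiagSums (w := w) (X := V) (ℓ := ℓ) hM hG hn0
    (fun τ => τ.1.1.charpoly_monic) (fun τ => by simp)
    (fun τ => coeff_zero_charpoly_ne_zero τ.2.2) (fun τ p => krylovForm_mul_charpoly _ _ _ p)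
    (fun τ => by simpa only [ℓ, krylovForm_X_pow] using τ.2.1)
    (Feasible.select V Sum.inl)
    -- The first row of `H` supplies `h_0, …, h_{n-1}` at no cost.
    ((Feasible.select V fun i : Fin n => .inr (.inl (⟨0, hn0⟩, i))).congr fun τ i => by
      simp [V, hankel])
  obtain ⟨P, hP⟩ := hfeas
  refine ⟨P, ?_⟩
  rintro A u v _ _ _ f rfl rfl rfl hH hA hf
  have := hP ⟨(A, u, v), hH, hA⟩
  obtain rfl := hf.eq_charpoly hH
  simpa only [V, ℓ, krylovForm_X_pow] using this
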